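/- Let $A\in\mathbb{R}_{\ge 0}^{d_1\times d_2}$ be a matrix with nonnegative entries in which no row and no column is all zeros. Let $\epsilon,p\in(0,1)$, $s=d_1+d_2$, let $r=A\mathbf 1$ and $c=A^{\top}\mathbf 1$ be the vectors of row and column sums, and let $R=\mathrm{diag}(r)$, $C=\mathrm{diag}(c)$. Let $\mathcal D$ be the probability distribution on $\mathbb{R}^{d_1\times d_2}$ under which a random matrix takes the value $$\frac{A_{ij}}{p_{ij}}\,\mathbf 1_i\mathbf 1_j^{\top}\quad\text{with probability}\quad p_{ij}=\frac{A_{ij}}{s}\left[\frac1{r_i}+\frac1{c_j}\right]\qquad\text{for all } (i,j) \text{ with } A_{ij}\neq 0,$$ where $\mathbf 1_i$ denotes the $i$-th standard basis vector. Let $A_1,\dots,A_k$ be sampled independently from $\mathcal D$, where $$k\ \ge\ 128\cdot\frac{s}{\epsilon^2}\,\log\frac{s}{p}$$ ($\log$ is the natural logarithm), and let $\widetilde A=\frac1k\sum_{l=1}^k A_l$. Then $$\Pr\left[\left\|R^{-1/2}(\widetilde A-A)C^{-1/2}\right\|_2\ge\epsilon\right]\le p,$$ $$\Pr\left[\left\|R^{-1}(\widetilde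 A-A)\mathbf 1\right\|_\infty\ge\epsilon\right]\le p,$$ $$\Pr\left[\left\|C^{-1}(\widetilde A-A)^{\top}\mathbf 1\right\|_\infty\ge\epsilon\right]\le p,$$ where $\|\cdot\|_2$ is the spectral norm of a matrix and $\|\cdot\|_\infty$ is the maximum norm of a vector. -/

import Mathlib

open MeasureTheory ProbabilityTheory
open scoped Matrix Matrix.Norms.L2Operator

/-- The product (entrywise Borel) sigma-algebra on real matrices. -/
instance matrixMeasurableSpace {d₁ d₂ : ℕ} : MeasurableSpace (Matrix (Fin d₁) (Fin d₂) ℝ) :=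
  inferInstanceAs (MeasurableSpace (Fin d₁ → Fin d₂ → ℝ))

/-- The row sums `r = A 𝟏`. -/
def rowSum {d₁ d₂ : ℕ} (A : Matrix (Fin d₁) (Fin d₂) ℝ) : Fin d₁ → ℝ := A *ᵥ 1

/-- The column sums `c = Aᵀ 𝟏`. -/
def colSum {d₁ d₂ : ℕ} (A : Matrix (Fin d₁) (Fin d₂) ℝ) : Fin d₂ → ℝ := Aᵀ *ᵥ 1

/-- The sampling probability `p_ij = (A_ij / s) (1 / r_i + 1 / c_j)`, where `s = d₁ + d₂`. -/
noncomputable def entryProb {d₁ d₂ : ℕ} (A : Matrix (Fin d₁) (Fin d₂) ℝ)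
    (i : Fin d₁) (j : Fin d₂) : ℝ :=
  A i j / ((d₁ : ℝ) + d₂) * (1 / rowSum A i + 1 / colSum A j)

/-- The distribution on `d₁ × d₂` matrices that takes the value `(A_ij / p_ij) 𝟏_i 𝟏_jᵀ`
with probability `p_ij`. Where `A_ij = 0` the weight `p_ij` is zero, so these pairs contribute
nothing. -/
noncomputable def entryDistribution {d₁ d₂ : ℕ} (A : Matrix (Fin d₁) (Fin d₂) ℝ) :
    Measure (Matrix (Fin d₁) (Fin d₂) ℝ) :=
  ∑ i, ∑ j, ENNReal.ofReal (entryProb A i j) •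
    Measure.dirac (Matrix.single i j (A i j / entryProb A i j))

/-- The weights `p_ij` do sum to one. -/
theorem isProbabilityMeasure_entryDistribution {d₁ d₂ : ℕ} (A : Matrix (Fin d₁) (Fin d₂) ℝ)
    (hd : 0 < d₁ + d₂) (hA : ∀ i j, 0 ≤ A i j)
    (hrow : ∀ i, ∃ j, A i j ≠ 0) (hcol : ∀ j, ∃ i, A i j ≠ 0) :
    IsProbabilityMeasure (entryDistribution A) := by
  have hr : ∀ i, rowSum A i = ∑ j, A i j := fun i => by
    simp [rowSum, Matrix.mulVec, dotProduct]
  have hc : ∀ j, colSum A j = ∑ i, A i j := fun j => by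
    simp [colSum, Matrix.mulVec, dotProduct]
  have hr0 : ∀ i, 0 < rowSum A i := fun i => by
    obtain ⟨j, hj⟩ := hrow i
    rw [hr]
    exact Finset.sum_pos' (fun j _ => hA i j) ⟨j, Finset.mem_univ _, (hA i j).lt_of_ne' hj⟩
  have hc0 : ∀ j, 0 < colSum A j := fun j => by
    obtain ⟨i, hi⟩ := hcol j
    rw [hc]
    exact Finset.sum_pos' (fun i _ => hA i j) ⟨i, Finset.mem_univ _, (hA i j).lt_of_ne' hi⟩
  have hp : ∀ i j, 0 ≤ entryProb A i j := fun i j => by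
    have h1 := (hr0 i).le
    have h2 := (hc0 j).le
    have h3 := hA i j
    unfold entryProb
    positivity
  have hs : (0 : ℝ) < (d₁ : ℝ) + d₂ := by exact_mod_cast hd
  have e1 : ∑ i, ∑ j, A i j / rowSum A i = (d₁ : ℝ) := by
    simp_rw [← Finset.sum_div, ← hr, div_self (hr0 _).ne']
    simp
  have e2 : ∑ i, ∑ j, A i j / colSum A j = (d₂ : ℝ) := by
    rw [Finset.sum_comm]
    simp_rw [← Finset.sum_div, ← hc, div_self (hc0 _).ne']
    simp
  have key : ∑ i, ∑ j, entryProb A i j = 1 := by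
    have h : ∀ i j, entryProb A i j
        = (A i j / rowSum A i + A i j / colSum A j) / ((d₁ : ℝ) + d₂) := fun i j => by
      unfold entryProb
      ring
    simp_rw [h, ← Finset.sum_div, Finset.sum_add_distrib]
    rw [e1, e2, div_self hs.ne']
  constructor
  simp only [entryDistribution, Measure.coe_finsetSum, Finset.sum_apply, Measure.smul_apply,
    measure_univ, smul_eq_mul, mul_one]
  rw [← ENNReal.ofReal_one, ← key, ENNReal.ofReal_sum_of_nonneg
    (fun i _ => Finset.sum_nonneg fun j _ => hp i j)]
  exact Finset.sum_congr rfl fun i _ => (ENNReal.ofReal_sum_of_nonneg fun j _ => hp i j).symm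

/-- The power `diag(v) ^ t` of a diagonal matrix with positive diagonal entries `v`. -/
noncomputable def diagPow {d : ℕ} (v : Fin d → ℝ) (t : ℝ) : Matrix (Fin d) (Fin d) ℝ :=
  Matrix.diagonal fun i => v i ^ t

/-- The average `(1 / k) ∑ Xᵢ` of `k` matrices. -/
noncomputable def sampleAverage {d₁ d₂ k : ℕ} (X : Fin k → Matrix (Fin d₁) (Fin d₂) ℝ) :
    Matrix (Fin d₁) (Fin d₂) ℝ :=
  (1 / (k : ℝ)) • ∑ i, X i

/-!
The three quantities are norms of images of `Ã - A` under linear maps into symmetric matrices of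
size at most `s = d₁ + d₂`: the symmetric dilation of `R^(-1/2) M C^(-1/2)` (whose norm bounds that
of the corner), and the diagonal matrices with diagonals `R⁻¹ M 𝟏` and `C⁻¹ Mᵀ 𝟏` (whose spectral
norms are the maximum norms of these vectors). A sample has the value `s r c / (r + c)` at its
position, and from this each map sends a sample to a matrix of norm at most `s` whose square has
expectation at most `s` times the identity. Centring gives summands of norm at most `2 s` and
variance at most `s`, so all three bounds are instances of one matrix Bernstein inequality,
`measureReal_le_norm_map_sampleAverage_sub_le`. At the Laplace parameter `ε / (2 s)` the failure
probability is at most `2 s exp (-k ε² / (4 s))`, which is well below `p` for the given `k`.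

The Bernstein inequality (`sum_prod_filter_le_norm_sum_le`) follows the Ahlswede–Winter argument.
The trace of the exponential of a sum of independent summands is estimated by splitting off one
summand at a time with the Golden–Thompson inequality `tr exp (X + Y) ≤ tr (exp X exp Y)`
(`trace_exp_add_le`); the expectation of the split-off factor is controlled by
`exp Y ≤ 1 + Y + Y²` for `‖Y‖ ≤ 1`. Golden–Thompson is the limit, by the Lie–Trotter formula
(`tendsto_exp_mul_exp_pow`), of `tr (X Y)^(2^k) ≤ tr (X^(2^k) Y^(2^k))` for symmetric matrices
(`trace_mul_pow_two_pow_le`), an iterated Cauchy–Schwarz inequality.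

Since the entry distribution has finite support, probabilities of events of the sample are finite
sums over the positions drawn (`measureReal_preimage_eq_sum`), and all expectations are finite sums.
-/

/-! ### The Golden–Thompson inequality -/

section GoldenThompson

open NormedSpace Filter Topology

variable {n : Type*} [Fintype n] [DecidableEq n]

omit [DecidableEq n] in
theorem sq_trace_mul_le (M N : Matrix n n ℝ) :
    (M * N).trace ^ 2 ≤ (M * Mᵀ).trace * (N * Nᵀ).trace := by
  have h := Finset.sum_mul_sq_le_sq_mul_sq (Finset.univ : Finset (n × n))
    (fun x => M x.1 x.2) (fun x => N x.2 x.1)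
  simp only [Fintype.sum_prod_type] at h
  simp only [Matrix.trace, Matrix.diag, Matrix.mul_apply, Matrix.transpose_apply, ← sq]
  refine h.trans (le_of_eq ?_)
  congr 1
  exact Finset.sum_comm

theorem trace_mul_pow_comm (M N : Matrix n n ℝ) (k : ℕ) :
    ((M * N) ^ k).trace = ((N * M) ^ k).trace := by
  cases k with
  | zero => simp
  | succ k =>
    have h : SemiconjBy N (M * N) (N * M) := by simp [SemiconjBy, mul_assoc]
    rw [pow_succ', pow_succ', mul_assoc, (h.pow_right k).eq, Matrix.trace_mul_comm, mul_assoc,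
      Matrix.trace_mul_comm]

/-- The Cauchy–Schwarz inequality for the trace, lifted to powers `2 ^ k`. One step applies the
inequality to the factors `M N` and `M N`, moves `M` cyclically so that `M N (M N)ᵀ` becomes
`(Mᵀ M) (N Nᵀ)`, and applies the inequality again to these two symmetric factors. -/
theorem sq_trace_mul_pow_le (k : ℕ) (M N : Matrix n n ℝ) :
    ((M * N) ^ 2 ^ k).trace ^ 2 ≤ ((M * Mᵀ) ^ 2 ^ k).trace * ((N * Nᵀ) ^ 2 ^ k).trace := by
  induction k generalizing M N with
  | zero => simpa using sq_trace_mul_le M N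
  | succ k ih =>
    have h₁ := ih (M * N) (M * N)
    have h₂ := ih (Mᵀ * M) (N * Nᵀ)
    have e : ((M * N * (M * N)ᵀ) ^ 2 ^ k).trace = ((Mᵀ * M * (N * Nᵀ)) ^ 2 ^ k).trace := by
      rw [Matrix.transpose_mul, ← mul_assoc, trace_mul_pow_comm]
      simp only [mul_assoc]
    simp only [Matrix.transpose_mul, Matrix.transpose_transpose] at h₂
    rw [e, ← sq] at h₁
    simp only [← sq, ← pow_mul] at h₁ h₂ ⊢
    rw [trace_mul_pow_comm Mᵀ M] at h₂
    rw [pow_succ' 2 k]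
    exact h₁.trans h₂

/-- A Lieb–Thirring type inequality: each step replaces `X`, `Y` by their squares and halves the
exponent. -/
theorem trace_mul_pow_two_pow_le (k : ℕ) {X Y : Matrix n n ℝ} (hX : Xᵀ = X) (hY : Yᵀ = Y) :
    ((X * Y) ^ 2 ^ k).trace ≤ (X ^ 2 ^ k * Y ^ 2 ^ k).trace := by
  induction k generalizing X Y with
  | zero => simp
  | succ k ih =>
    have h := sq_trace_mul_pow_le k (X * Y) (X * Y)
    have hp : 0 ≤ ((X * Y * (X * Y)ᵀ) ^ 2 ^ k).trace := by
      have := (Matrix.posSemidef_self_mul_conjTranspose (X * Y)).pow (2 ^ k)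
      simpa using this.trace_nonneg
    rw [← sq] at h
    have h' := abs_le_of_sq_le_sq (h.trans_eq (sq _).symm) hp
    rw [← pow_mul, ← pow_succ'] at h'
    refine (le_abs_self _).trans (h'.trans ?_)
    have e : ((X * Y * (X * Y)ᵀ) ^ 2 ^ k).trace = ((X ^ 2 * Y ^ 2) ^ 2 ^ k).trace := by
      rw [Matrix.transpose_mul, hX, hY, ← mul_assoc, trace_mul_pow_comm]
      simp only [mul_assoc, sq]
    rw [e]
    refine (ih (X := X ^ 2) (Y := Y ^ 2) (by rw [Matrix.transpose_pow, hX])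
      (by rw [Matrix.transpose_pow, hY])).trans_eq ?_
    rw [← pow_mul, ← pow_mul, ← pow_succ']

theorem norm_pow_sub_pow_le {𝔸 : Type*} [NormedRing 𝔸] [NormOneClass 𝔸] {a b : 𝔸} {r : ℝ}
    (ha : ‖a‖ ≤ r) (hb : ‖b‖ ≤ r) (hr : 1 ≤ r) (k : ℕ) :
    ‖a ^ k - b ^ k‖ ≤ k * r ^ k * ‖a - b‖ := by
  induction k with
  | zero => simp
  | succ k ih =>
    have e : a ^ (k + 1) - b ^ (k + 1) = a ^ k * (a - b) + (a ^ k - b ^ k) * b := by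
      rw [pow_succ, pow_succ]; noncomm_ring
    have hr0 : 0 ≤ r := zero_le_one.trans hr
    have h₁ : ‖a ^ k * (a - b)‖ ≤ r ^ (k + 1) * ‖a - b‖ :=
      (norm_mul_le _ _).trans <| by
        gcongr
        exact ((norm_pow_le _ _).trans (pow_le_pow_left₀ (norm_nonneg _) ha _)).trans
          (pow_le_pow_right₀ hr k.le_succ)
    have h₂ : ‖(a ^ k - b ^ k) * b‖ ≤ k * r ^ k * ‖a - b‖ * r :=
      (norm_mul_le _ _).trans (mul_le_mul ih hb (norm_nonneg _) (by positivity))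
    rw [e]
    refine (norm_add_le _ _).trans ((add_le_add h₁ h₂).trans_eq ?_)
    push_cast
    ring

theorem norm_exp_le_exp_norm {𝔸 : Type*} [NormedRing 𝔸] [NormedAlgebra ℝ 𝔸] [CompleteSpace 𝔸]
    [NormOneClass 𝔸] (a : 𝔸) : ‖exp a‖ ≤ Real.exp ‖a‖ := by
  rw [Real.exp_eq_exp_ℝ, exp_eq_tsum ℝ, exp_eq_tsum ℝ]
  refine tsum_of_norm_bounded (expSeries_summable' (𝕂 := ℝ) ‖a‖).hasSum fun i => ?_
  rw [norm_smul, norm_inv, Real.norm_natCast, smul_eq_mul]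
  gcongr
  exact norm_pow_le _ _

/-- **Lie–Trotter product formula**. The curves `t ↦ exp (t a) exp (t b)` and
`t ↦ exp (t (a + b))` have the same value and derivative at `0`, so that at `t = 1 / k` they
differ by `o(1 / k)`, and telescoping the `k`-th powers multiplies this error by `O(k)`. -/
theorem tendsto_exp_mul_exp_pow {𝔸 : Type*} [NormedRing 𝔸] [NormedAlgebra ℝ 𝔸] [CompleteSpace 𝔸]
    [NormOneClass 𝔸] (a b : 𝔸) :
    Tendsto (fun k : ℕ => (exp ((k : ℝ)⁻¹ • a) * exp ((k : ℝ)⁻¹ • b)) ^ k) atTop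
      (𝓝 (exp (a + b))) := by
  have hd : HasDerivAt (fun t : ℝ => exp (t • a) * exp (t • b) - exp (t • (a + b))) 0 0 := by
    have := ((hasDerivAt_exp_smul_const a (0 : ℝ)).mul (hasDerivAt_exp_smul_const b (0 : ℝ))).sub
      (hasDerivAt_exp_smul_const (a + b) (0 : ℝ))
    refine this.congr_deriv ?_
    simp
  have hinv : Tendsto (fun k : ℕ => (k : ℝ)⁻¹) atTop (𝓝[≠] 0) :=
    tendsto_inv_atTop_nhdsGT_zero.comp tendsto_natCast_atTop_atTop |>.mono_right
      (nhdsWithin_mono _ fun x hx => ne_of_gt hx)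
  have h0 : Tendsto (fun k : ℕ => (k : ℝ) *
      ‖exp ((k : ℝ)⁻¹ • a) * exp ((k : ℝ)⁻¹ • b) - exp ((k : ℝ)⁻¹ • (a + b))‖) atTop (𝓝 0) := by
    have := (hd.tendsto_slope_zero.comp hinv).norm
    simpa [Function.comp_def, norm_smul, -smul_add] using this
  rw [tendsto_iff_norm_sub_tendsto_zero]
  refine squeeze_zero' (Eventually.of_forall fun _ => norm_nonneg _) ?_
    (by simpa only [mul_zero] using h0.const_mul (Real.exp (‖a‖ + ‖b‖)))
  filter_upwards [eventually_ge_atTop 1] with k hk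
  have hk0 : (k : ℝ) ≠ 0 := by positivity
  have hpow : exp (a + b) = exp ((k : ℝ)⁻¹ • (a + b)) ^ k := by
    let +nondep : NormedAlgebra ℚ 𝔸 := .restrictScalars ℚ ℝ 𝔸
    rw [← exp_nsmul, ← Nat.cast_smul_eq_nsmul ℝ, smul_smul, mul_inv_cancel₀ hk0, one_smul]
  set r := Real.exp ((k : ℝ)⁻¹ * (‖a‖ + ‖b‖)) with hr
  have hn : ∀ c : 𝔸, ‖(k : ℝ)⁻¹ • c‖ = (k : ℝ)⁻¹ * ‖c‖ := fun c => by
    rw [norm_smul, norm_inv, Real.norm_natCast]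
  have h₁ : ‖exp ((k : ℝ)⁻¹ • a) * exp ((k : ℝ)⁻¹ • b)‖ ≤ r := by
    rw [hr, mul_add, Real.exp_add, ← hn, ← hn]
    exact (norm_mul_le _ _).trans (mul_le_mul (norm_exp_le_exp_norm _) (norm_exp_le_exp_norm _)
      (norm_nonneg _) (Real.exp_nonneg _))
  have h₂ : ‖exp ((k : ℝ)⁻¹ • (a + b))‖ ≤ r := by
    refine (norm_exp_le_exp_norm _).trans (Real.exp_le_exp.2 ?_)
    rw [hn]
    gcongr
    exact norm_add_le _ _
  have hrk : r ^ k = Real.exp (‖a‖ + ‖b‖) := by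
    rw [hr, ← Real.exp_nat_mul, ← mul_assoc, mul_inv_cancel₀ hk0, one_mul]
  rw [hpow]
  refine (norm_pow_sub_pow_le h₁ h₂ (Real.one_le_exp (by positivity)) k).trans_eq ?_
  rw [hrk]
  ring

/-- **Golden–Thompson inequality** for real symmetric matrices. -/
theorem trace_exp_add_le [Nonempty n] {X Y : Matrix n n ℝ} (hX : X.IsHermitian)
    (hY : Y.IsHermitian) : (exp (X + Y)).trace ≤ (exp X * exp Y).trace := by
  have hlim : Tendsto (fun k : ℕ => ((exp (((2 ^ k : ℕ) : ℝ)⁻¹ • X) *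
      exp (((2 ^ k : ℕ) : ℝ)⁻¹ • Y)) ^ 2 ^ k).trace) atTop (𝓝 (exp (X + Y)).trace) :=
    ((continuous_id.matrix_trace.tendsto _).comp (tendsto_exp_mul_exp_pow X Y)).comp
      (tendsto_pow_atTop_atTop_of_one_lt one_lt_two)
  refine le_of_tendsto' hlim fun k => ?_
  have hsymm : ∀ {Z : Matrix n n ℝ}, Z.IsHermitian → ∀ t : ℝ, (exp (t • Z))ᵀ = exp (t • Z) := by
    intro Z hZ t
    rw [← Matrix.exp_transpose, Matrix.transpose_smul]
    rw [Matrix.IsHermitian, Matrix.conjTranspose_eq_transpose_of_trivial] at hZ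
    rw [hZ]
  have hpow : ∀ Z : Matrix n n ℝ, exp (((2 ^ k : ℕ) : ℝ)⁻¹ • Z) ^ 2 ^ k = exp Z := by
    intro Z
    rw [← Matrix.exp_nsmul, ← Nat.cast_smul_eq_nsmul ℝ, smul_smul,
      mul_inv_cancel₀ (by positivity), one_smul]
  refine (trace_mul_pow_two_pow_le k (hsymm hX _) (hsymm hY _)).trans_eq ?_
  rw [hpow, hpow]

end GoldenThompson

/-! ### A matrix Bernstein inequality for finitely supported distributions -/

section MatrixBernstein

open NormedSpace

variable {n : Type*} [Fintype n] [DecidableEq n]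

/-- The spectral theorem, together with the norm as the largest absolute value of an eigenvalue. -/
theorem exists_unitary_conj_diagonal {Y : Matrix n n ℝ} (hY : Y.IsHermitian) :
    ∃ (U : unitary (Matrix n n ℝ)) (v : n → ℝ),
      Y = U * Matrix.diagonal v * star (U : Matrix n n ℝ) ∧ ‖Y‖ = ‖v‖ := by
  have h : Y = hY.eigenvectorUnitary * Matrix.diagonal hY.eigenvalues *
      star (hY.eigenvectorUnitary : Matrix n n ℝ) := by
    conv_lhs => rw [hY.spectral_theorem, Unitary.conjStarAlgAut_apply]
    rfl
  refine ⟨hY.eigenvectorUnitary, hY.eigenvalues, h, ?_⟩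
  conv_lhs => rw [h]
  rw [← Unitary.coe_star, CStarRing.norm_mul_coe_unitary, CStarRing.norm_coe_unitary_mul,
    Matrix.l2_opNorm_diagonal]

theorem exp_unitary_conj_diagonal (U : unitary (Matrix n n ℝ)) (v : n → ℝ) :
    exp (U * Matrix.diagonal v * star (U : Matrix n n ℝ)) =
      U * Matrix.diagonal (fun i => Real.exp (v i)) * star (U : Matrix n n ℝ) := by
  have h := Matrix.exp_units_conj (Unitary.toUnits U) (Matrix.diagonal v)
  have e : (fun i => Real.exp (v i)) = exp v := by
    rw [Pi.exp_def, Real.exp_eq_exp_ℝ]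
  rw [e, ← Matrix.exp_diagonal]
  exact h

theorem posSemidef_exp {Y : Matrix n n ℝ} (hY : Y.IsHermitian) : (exp Y).PosSemidef := by
  obtain ⟨U, v, h, -⟩ := exists_unitary_conj_diagonal hY
  rw [h, exp_unitary_conj_diagonal, Matrix.star_eq_conjTranspose]
  exact (Matrix.PosSemidef.diagonal fun i => (Real.exp_pos _).le).mul_mul_conjTranspose_same _

/-- `exp Y ≤ 1 + Y + Y ^ 2` in the Loewner order. -/
theorem posSemidef_one_add_add_sq_sub_exp {Y : Matrix n n ℝ} (hY : Y.IsHermitian)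
    (h1 : ‖Y‖ ≤ 1) : (1 + Y + Y ^ 2 - exp Y).PosSemidef := by
  obtain ⟨U, v, h, hn⟩ := exists_unitary_conj_diagonal hY
  have hU : star (U : Matrix n n ℝ) * U = 1 := Unitary.coe_star_mul_self U
  have hU' : (U : Matrix n n ℝ) * star (U : Matrix n n ℝ) = 1 := Unitary.coe_mul_star_self U
  have e : 1 + Y + Y ^ 2 - exp Y = (U : Matrix n n ℝ) *
      Matrix.diagonal (fun i => 1 + v i + v i ^ 2 - Real.exp (v i)) * star (U : Matrix n n ℝ) := by
    have h2 : Y ^ 2 = (U : Matrix n n ℝ) * Matrix.diagonal (fun i => v i ^ 2) * star (U : Matrix n n ℝ) := by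
      have : Matrix.diagonal (fun i => v i ^ 2) = Matrix.diagonal v * Matrix.diagonal v := by
        simp [sq]
      rw [this, sq, h]
      calc _ = U * Matrix.diagonal v * (star (U : Matrix n n ℝ) * U) * Matrix.diagonal v *
            star (U : Matrix n n ℝ) := by simp only [mul_assoc]
        _ = _ := by rw [hU, mul_one]; simp only [mul_assoc]
    have e1 : Matrix.diagonal (fun i => 1 + v i + v i ^ 2 - Real.exp (v i)) =
        1 + Matrix.diagonal v + Matrix.diagonal (fun i => v i ^ 2) -
          Matrix.diagonal (fun i => Real.exp (v i)) := by
      rw [← Matrix.diagonal_one, Matrix.diagonal_add, Matrix.diagonal_add, Matrix.diagonal_sub]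
    rw [h2, e1, mul_sub, mul_add, mul_add, sub_mul, add_mul, add_mul, mul_one, hU', ← h,
      ← exp_unitary_conj_diagonal, ← h]
  rw [e, Matrix.star_eq_conjTranspose]
  refine (Matrix.PosSemidef.diagonal fun i => ?_).mul_mul_conjTranspose_same _
  have hv : |v i| ≤ 1 := (norm_le_pi_norm v i).trans (hn ▸ h1)
  have := (abs_le.1 (Real.abs_exp_sub_one_sub_id_le hv)).2
  change 0 ≤ _
  linarith

omit [DecidableEq n] in
theorem trace_mul_nonneg {P Q : Matrix n n ℝ} (hP : P.PosSemidef) (hQ : Q.PosSemidef) :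
    0 ≤ (P * Q).trace := by
  classical
  open scoped MatrixOrder in
  obtain ⟨B, rfl⟩ := CStarAlgebra.nonneg_iff_eq_star_mul_self.1 hP.nonneg
  rw [Matrix.star_eq_conjTranspose, mul_assoc, Matrix.trace_mul_comm]
  exact (hQ.mul_mul_conjTranspose_same B).trace_nonneg

/-- The norm of `S` is `|λ|` for some eigenvalue `λ`, and `exp (θ |λ|)` is one term of one of the
two traces. -/
theorem exp_le_trace_exp_add_trace_exp_neg [Nonempty n] {S : Matrix n n ℝ} (hS : S.IsHermitian)
    {a θ : ℝ} (hθ : 0 ≤ θ) (ha : a ≤ ‖S‖) :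
    Real.exp (θ * a) ≤ (exp (θ • S)).trace + (exp (θ • -S)).trace := by
  obtain ⟨U, v, h, hn⟩ := exists_unitary_conj_diagonal hS
  have htr : ∀ t : ℝ, (exp (t • S)).trace = ∑ i, Real.exp (t * v i) := by
    intro t
    have : t • S = U * Matrix.diagonal (fun i => t * v i) * star (U : Matrix n n ℝ) := by
      have e : Matrix.diagonal (fun i => t * v i) = t • Matrix.diagonal v := by
        rw [← Matrix.diagonal_smul]; rfl
      rw [e, Matrix.mul_smul, Matrix.smul_mul, ← h]
    rw [this, exp_unitary_conj_diagonal, Matrix.trace_mul_comm, ← mul_assoc,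
      Unitary.coe_star_mul_self, one_mul, Matrix.trace_diagonal]
  rw [smul_neg, ← neg_smul, htr, htr]
  obtain ⟨i, hi⟩ : ∃ i, ‖v‖ = ‖v i‖ := by
    obtain ⟨i, -, hi⟩ := Finset.exists_mem_eq_sup' Finset.univ_nonempty (fun i => ‖v i‖₊)
    refine ⟨i, ?_⟩
    rw [← coe_nnnorm, ← coe_nnnorm, Pi.nnnorm_def, ← hi, Finset.sup'_eq_sup]
  have hle : ∀ t : ℝ, Real.exp (t * v i) ≤ ∑ j, Real.exp (t * v j) := fun t =>
    Finset.single_le_sum (f := fun j => Real.exp (t * v j)) (fun j _ => (Real.exp_pos _).le)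
      (Finset.mem_univ i)
  have hnn : ∀ t : ℝ, 0 ≤ ∑ j, Real.exp (t * v j) := fun t =>
    Finset.sum_nonneg fun j _ => (Real.exp_pos _).le
  rw [hn, hi, Real.norm_eq_abs] at ha
  rcases abs_cases (v i) with ⟨h', -⟩ | ⟨h', -⟩ <;> rw [h'] at ha
  · have := Real.exp_le_exp.2 (mul_le_mul_of_nonneg_left ha hθ)
    linarith [hle θ, hnn (-θ)]
  · have : Real.exp (θ * a) ≤ Real.exp (-θ * v i) :=
      Real.exp_le_exp.2 ((mul_le_mul_of_nonneg_left ha hθ).trans_eq (by ring))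
    linarith [hle (-θ), hnn θ]

variable {ι : Type*} [Fintype ι]

/-- The moment generating function of a sum of `k` independent random matrices, each equal to
`Y i` with probability `w i`: peeling off one summand by Golden–Thompson costs a factor `c`. -/
theorem sum_prod_mul_trace_exp_sum_le [Nonempty n] {w : ι → ℝ} (hw : ∀ i, 0 ≤ w i)
    {Y : ι → Matrix n n ℝ} (hY : ∀ i, (Y i).IsHermitian) {c : ℝ} (hc : 0 ≤ c)
    (h : (c • (1 : Matrix n n ℝ) - ∑ i, w i • exp (Y i)).PosSemidef) (k : ℕ) :
    ∑ f : Fin k → ι, (∏ l, w (f l)) * (exp (∑ l, Y (f l))).trace ≤ c ^ k * Fintype.card n := by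
  induction k with
  | zero => simp
  | succ k ih =>
    rw [← (Fin.consEquiv fun _ : Fin (k + 1) => ι).sum_comp, Fintype.sum_prod_type_right]
    have hstep : ∀ g : Fin k → ι, ∑ i, (∏ l, w ((Fin.consEquiv fun _ => ι) (i, g) l)) *
        (exp (∑ l, Y ((Fin.consEquiv fun _ => ι) (i, g) l))).trace ≤
        c * ((∏ l, w (g l)) * (exp (∑ l, Y (g l))).trace) := by
      intro g
      simp only [Fin.consEquiv_apply, Fin.prod_univ_succ, Fin.sum_univ_succ, Fin.cons_zero,
        Fin.cons_succ]
      have hS : (∑ l, Y (g l)).IsHermitian :=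
        isSelfAdjoint_sum _ fun l _ => hY (g l)
      have hp : 0 ≤ ∏ l, w (g l) := Finset.prod_nonneg fun l _ => hw _
      have h1 := trace_mul_nonneg h (posSemidef_exp hS)
      rw [sub_mul, Matrix.trace_sub, smul_mul_assoc, one_mul, Matrix.trace_smul, Finset.sum_mul,
        Matrix.trace_sum, smul_eq_mul, sub_nonneg] at h1
      calc _ ≤ ∑ i, (∏ l, w (g l)) * (w i • exp (Y i) * exp (∑ l, Y (g l))).trace := by
            refine Finset.sum_le_sum fun i _ => ?_
            rw [smul_mul_assoc, Matrix.trace_smul, smul_eq_mul, mul_comm (w i), mul_assoc]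
            exact mul_le_mul_of_nonneg_left (mul_le_mul_of_nonneg_left
              (trace_exp_add_le (hY i) hS) (hw i)) hp
        _ ≤ _ := by
            rw [← Finset.mul_sum, mul_left_comm]
            exact mul_le_mul_of_nonneg_left h1 hp
    refine (Finset.sum_le_sum fun g _ => hstep g).trans ?_
    rw [← Finset.mul_sum, pow_succ', mul_assoc]
    exact mul_le_mul_of_nonneg_left ih hc

/-- The factor by which a centred summand of variance at most `v` multiplies the moment generating
function at a parameter `θ` with `|θ| ‖Y i‖ ≤ 1`. -/
theorem posSemidef_exp_smul_one_sub_sum {w : ι → ℝ} (hw : ∀ i, 0 ≤ w i) (hw1 : ∑ i, w i = 1)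
    {Y : ι → Matrix n n ℝ} (hY : ∀ i, (Y i).IsHermitian) (hY0 : ∑ i, w i • Y i = 0) {v θ : ℝ}
    (hθ : ∀ i, ‖θ • Y i‖ ≤ 1)
    (hv : (v • (1 : Matrix n n ℝ) - ∑ i, w i • Y i ^ 2).PosSemidef) :
    (Real.exp (θ ^ 2 * v) • (1 : Matrix n n ℝ) - ∑ i, w i • exp (θ • Y i)).PosSemidef := by
  have e : Real.exp (θ ^ 2 * v) • (1 : Matrix n n ℝ) - ∑ i, w i • exp (θ • Y i) =
      (Real.exp (θ ^ 2 * v) - 1 - θ ^ 2 * v) • (1 : Matrix n n ℝ) +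
      θ ^ 2 • (v • (1 : Matrix n n ℝ) - ∑ i, w i • Y i ^ 2) +
      ∑ i, w i • (1 + θ • Y i + (θ • Y i) ^ 2 - exp (θ • Y i)) := by
    have e1 : ∑ i, w i • θ • Y i = 0 := by
      simp_rw [smul_comm _ θ, ← Finset.smul_sum, hY0, smul_zero]
    have e2 : ∑ i, w i • (θ • Y i) ^ 2 = θ ^ 2 • ∑ i, w i • Y i ^ 2 := by
      simp_rw [smul_pow, smul_comm _ (θ ^ 2), ← Finset.smul_sum]
    simp only [smul_sub, smul_add, Finset.sum_add_distrib, Finset.sum_sub_distrib, e1, e2,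
      ← Finset.sum_smul, hw1]
    module
  rw [e]
  have hs : ∀ i, (θ • Y i).IsHermitian := fun i =>
    IsSelfAdjoint.smul (IsSelfAdjoint.all θ) (hY i)
  refine ((Matrix.PosSemidef.one.smul ?_).add (hv.smul (sq_nonneg θ))).add
    (Matrix.posSemidef_sum _ fun i _ =>
      (posSemidef_one_add_add_sq_sub_exp (hs i) (hθ i)).smul (hw i))
  linarith [Real.add_one_le_exp (θ ^ 2 * v)]

/-- **Matrix Bernstein inequality** for the sum of `k` independent random symmetric matrices, each
equal to `Y i` with probability `w i`, with the free parameter `θ` of the Laplace transform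
method. -/
theorem sum_prod_filter_le_norm_sum_le {w : ι → ℝ} (hw : ∀ i, 0 ≤ w i) (hw1 : ∑ i, w i = 1)
    {Y : ι → Matrix n n ℝ} (hY : ∀ i, (Y i).IsHermitian) (hY0 : ∑ i, w i • Y i = 0) {v θ a : ℝ}
    (hθ0 : 0 ≤ θ) (hθ : ∀ i, ‖θ • Y i‖ ≤ 1)
    (hv : (v • (1 : Matrix n n ℝ) - ∑ i, w i • Y i ^ 2).PosSemidef) (ha : 0 < a) (k : ℕ) :
    ∑ f : Fin k → ι with a ≤ ‖∑ l, Y (f l)‖, ∏ l, w (f l) ≤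
      2 * Fintype.card n * Real.exp (k * (θ ^ 2 * v) - θ * a) := by
  cases isEmpty_or_nonempty n with
  | inl h =>
    have hz : ∀ S : Matrix n n ℝ, ‖S‖ = 0 := fun S => by
      rw [Subsingleton.elim S 0, norm_zero]
    simp [hz, ha.not_ge]
  | inr h =>
    have hp : ∀ f : Fin k → ι, 0 ≤ ∏ l, w (f l) := fun f => Finset.prod_nonneg fun l _ => hw _
    have hS : ∀ f : Fin k → ι, (∑ l, Y (f l)).IsHermitian := fun f =>
      isSelfAdjoint_sum _ fun l _ => hY (f l)
    have hs : ∀ i, (θ • Y i).IsHermitian := fun i =>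
      IsSelfAdjoint.smul (IsSelfAdjoint.all θ) (hY i)
    have hs' : ∀ i, (θ • -Y i).IsHermitian := fun i =>
      IsSelfAdjoint.smul (IsSelfAdjoint.all θ) (hY i).neg
    have m1 := sum_prod_mul_trace_exp_sum_le hw hs (Real.exp_pos _).le
      (posSemidef_exp_smul_one_sub_sum hw hw1 hY hY0 hθ hv) k
    have m2 := sum_prod_mul_trace_exp_sum_le hw hs' (Real.exp_pos _).le
      (posSemidef_exp_smul_one_sub_sum (Y := fun i => -Y i) hw hw1 (fun i => (hY i).neg)
        (by simpa using hY0) (by simpa using hθ) (by simpa using hv)) k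
    simp only [← Finset.smul_sum, Finset.sum_neg_distrib] at m1 m2
    have key : Real.exp (θ * a) * ∑ f : Fin k → ι with a ≤ ‖∑ l, Y (f l)‖, ∏ l, w (f l) ≤
        2 * Fintype.card n * Real.exp (θ ^ 2 * v) ^ k := by
      calc _ ≤ ∑ f : Fin k → ι with a ≤ ‖∑ l, Y (f l)‖, (∏ l, w (f l)) *
            ((exp (θ • ∑ l, Y (f l))).trace + (exp (θ • -∑ l, Y (f l))).trace) := by
            rw [Finset.mul_sum]
            refine Finset.sum_le_sum fun f hf => ?_
            rw [mul_comm]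
            exact mul_le_mul_of_nonneg_left (exp_le_trace_exp_add_trace_exp_neg (hS f) hθ0
              (Finset.mem_filter.1 hf).2) (hp f)
        _ ≤ ∑ f : Fin k → ι, (∏ l, w (f l)) *
            ((exp (θ • ∑ l, Y (f l))).trace + (exp (θ • -∑ l, Y (f l))).trace) := by
            refine Finset.sum_le_sum_of_subset_of_nonneg (Finset.filter_subset _ _)
              fun f _ _ => mul_nonneg (hp f) (add_nonneg ?_ ?_)
            · exact (posSemidef_exp (IsSelfAdjoint.smul (IsSelfAdjoint.all θ) (hS f))).trace_nonneg
            · exact (posSemidef_exp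
                (IsSelfAdjoint.smul (IsSelfAdjoint.all θ) (hS f).neg)).trace_nonneg
        _ ≤ _ := by
            simp only [mul_add, Finset.sum_add_distrib]
            linarith
    rw [Real.exp_sub, Real.exp_nat_mul, mul_div_assoc', le_div_iff₀ (Real.exp_pos _), mul_comm]
    exact key

end MatrixBernstein

/-! ### Sampling entries -/

section EntrySampling

variable {d₁ d₂ : ℕ} {A : Matrix (Fin d₁) (Fin d₂) ℝ}

theorem rowSum_apply (A : Matrix (Fin d₁) (Fin d₂) ℝ) (i : Fin d₁) :
    rowSum A i = ∑ j, A i j := by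
  simp [rowSum, Matrix.mulVec, dotProduct]

theorem colSum_apply (A : Matrix (Fin d₁) (Fin d₂) ℝ) (j : Fin d₂) :
    colSum A j = ∑ i, A i j := by
  simp [colSum, Matrix.mulVec, dotProduct]

theorem rowSum_pos (hA : ∀ i j, 0 ≤ A i j) (hrow : ∀ i, ∃ j, A i j ≠ 0) (i : Fin d₁) :
    0 < rowSum A i := by
  obtain ⟨j, hj⟩ := hrow i
  rw [rowSum_apply]
  exact Finset.sum_pos' (fun j _ => hA i j) ⟨j, Finset.mem_univ _, (hA i j).lt_of_ne' hj⟩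

theorem colSum_pos (hA : ∀ i j, 0 ≤ A i j) (hcol : ∀ j, ∃ i, A i j ≠ 0) (j : Fin d₂) :
    0 < colSum A j := by
  obtain ⟨i, hi⟩ := hcol j
  rw [colSum_apply]
  exact Finset.sum_pos' (fun i _ => hA i j) ⟨i, Finset.mem_univ _, (hA i j).lt_of_ne' hi⟩

theorem sum_sum_single_div_rowSum (hr : ∀ i, 0 < rowSum A i) (a : Fin d₁) :
    ∑ i, ∑ j, (Pi.single i (A i j / rowSum A i) : Fin d₁ → ℝ) a = 1 := by
  rw [Finset.sum_eq_single a (fun i _ hi => by simp [hi.symm]) (by simp)]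
  simp only [Pi.single_eq_same]
  rw [← Finset.sum_div, ← rowSum_apply, div_self (hr a).ne']

theorem sum_sum_single_div_colSum (hc : ∀ j, 0 < colSum A j) (b : Fin d₂) :
    ∑ i, ∑ j, (Pi.single j (A i j / colSum A j) : Fin d₂ → ℝ) b = 1 := by
  rw [Finset.sum_comm, Finset.sum_eq_single b (fun i _ hi => by simp [hi.symm]) (by simp)]
  simp only [Pi.single_eq_same]
  rw [← Finset.sum_div, ← colSum_apply, div_self (hc b).ne']

theorem entryProb_nonneg (hA : ∀ i j, 0 ≤ A i j) (hr : ∀ i, 0 < rowSum A i)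
    (hc : ∀ j, 0 < colSum A j) (i : Fin d₁) (j : Fin d₂) : 0 ≤ entryProb A i j := by
  have h1 := (hr i).le
  have h2 := (hc j).le
  have h3 := hA i j
  unfold entryProb
  positivity

theorem sum_sum_entryProb (hs : 0 < d₁ + d₂) (hr : ∀ i, 0 < rowSum A i)
    (hc : ∀ j, 0 < colSum A j) : ∑ i, ∑ j, entryProb A i j = 1 := by
  have hs' : (0 : ℝ) < (d₁ : ℝ) + d₂ := by exact_mod_cast hs
  have h : ∀ i j, entryProb A i j
      = (A i j / rowSum A i + A i j / colSum A j) / ((d₁ : ℝ) + d₂) := fun i j => by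
    unfold entryProb
    ring
  have e1 : ∑ i, ∑ j, A i j / rowSum A i = (d₁ : ℝ) := by
    simp_rw [← Finset.sum_div, ← rowSum_apply, div_self (hr _).ne']
    simp
  have e2 : ∑ i, ∑ j, A i j / colSum A j = (d₂ : ℝ) := by
    rw [Finset.sum_comm]
    simp_rw [← Finset.sum_div, ← colSum_apply, div_self (hc _).ne']
    simp
  simp_rw [h, ← Finset.sum_div, Finset.sum_add_distrib]
  rw [e1, e2, div_self hs'.ne']

/-- The value of a sampled entry. For `A i j = 0` the left side is `0 / 0`, hence `0`. -/
theorem div_entryProb_of_ne_zero {i : Fin d₁} {j : Fin d₂} (hr : 0 < rowSum A i)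
    (hc : 0 < colSum A j) (h : A i j ≠ 0) :
    A i j / entryProb A i j =
      ((d₁ : ℝ) + d₂) * (rowSum A i * colSum A j / (rowSum A i + colSum A j)) := by
  have hd : (0 : ℝ) < (d₁ : ℝ) + d₂ := by
    have := i.pos
    positivity
  unfold entryProb
  field_simp
  ring

theorem entryProb_mul_div {i : Fin d₁} {j : Fin d₂} (hr : 0 < rowSum A i)
    (hc : 0 < colSum A j) : entryProb A i j * (A i j / entryProb A i j) = A i j := by
  by_cases h : A i j = 0
  · simp [h]
  refine mul_div_cancel₀ _ fun h0 => ?_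
  have h1 := div_entryProb_of_ne_zero hr hc h
  have hd : (0 : ℝ) < (d₁ : ℝ) + d₂ := by
    have := i.pos
    positivity
  rw [h0, div_zero] at h1
  have : 0 < ((d₁ : ℝ) + d₂) * (rowSum A i * colSum A j / (rowSum A i + colSum A j)) := by
    positivity
  exact this.ne h1

theorem entryProb_mul_div_sq {i : Fin d₁} {j : Fin d₂} (hr : 0 < rowSum A i)
    (hc : 0 < colSum A j) : entryProb A i j * (A i j / entryProb A i j) ^ 2 =
      ((d₁ : ℝ) + d₂) * (A i j * (rowSum A i * colSum A j / (rowSum A i + colSum A j))) := by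
  by_cases h : A i j = 0
  · simp [h]
  rw [sq, ← mul_assoc, entryProb_mul_div hr hc, div_entryProb_of_ne_zero hr hc h]
  ring

instance borelSpaceMatrix : BorelSpace (Matrix (Fin d₁) (Fin d₂) ℝ) :=
  inferInstanceAs (BorelSpace (Fin d₁ → Fin d₂ → ℝ))

instance secondCountableTopologyMatrix : SecondCountableTopology (Matrix (Fin d₁) (Fin d₂) ℝ) :=
  inferInstanceAs (SecondCountableTopology (Fin d₁ → Fin d₂ → ℝ))

/-- Probabilities of events of a `k`-fold sample are finite sums over the sampled positions. -/
theorem measureReal_preimage_eq_sum (hd : 0 < d₁ + d₂) (hA : ∀ i j, 0 ≤ A i j)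
    (hr : ∀ i, 0 < rowSum A i) (hc : ∀ j, 0 < colSum A j) {k : ℕ}
    {Ω : Type*} [MeasurableSpace Ω] {μ : Measure Ω} [IsProbabilityMeasure μ]
    {X : Fin k → Ω → Matrix (Fin d₁) (Fin d₂) ℝ}
    (hlaw : ∀ l, HasLaw (X l) (entryDistribution A) μ) (hindep : iIndepFun X μ)
    {P : (Fin k → Matrix (Fin d₁) (Fin d₂) ℝ) → Prop} [DecidablePred P]
    (hP : MeasurableSet {x | P x}) :
    μ.real {ω | P fun l => X l ω} =
      ∑ f : Fin k → Fin d₁ × Fin d₂ with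
        P fun l => Matrix.single (f l).1 (f l).2 (A (f l).1 (f l).2 / entryProb A (f l).1 (f l).2),
        ∏ l, entryProb A (f l).1 (f l).2 := by
  have hp0 := entryProb_nonneg hA hr hc
  let ν : Measure (Fin d₁ × Fin d₂) := ∑ x, ENNReal.ofReal (entryProb A x.1 x.2) • Measure.dirac x
  let φ : Fin d₁ × Fin d₂ → Matrix (Fin d₁) (Fin d₂) ℝ := fun x =>
    Matrix.single x.1 x.2 (A x.1 x.2 / entryProb A x.1 x.2)
  have hφ : Measurable φ := .of_discrete
  have hν1 : ∀ x, ν {x} = ENNReal.ofReal (entryProb A x.1 x.2) := by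
    intro x
    simp only [ν, Measure.coe_finsetSum, Finset.sum_apply, Measure.smul_apply, smul_eq_mul]
    rw [Finset.sum_eq_single x (fun y _ hy => by simp [hy]) (by simp)]
    simp
  have : IsProbabilityMeasure ν := by
    constructor
    simp only [ν, Measure.coe_finsetSum, Finset.sum_apply, Measure.smul_apply,
      measure_univ, smul_eq_mul, mul_one]
    rw [← ENNReal.ofReal_sum_of_nonneg fun x _ => hp0 _ _, Fintype.sum_prod_type,
      sum_sum_entryProb hd hr hc, ENNReal.ofReal_one]
  have hmap : entryDistribution A = ν.map φ := by
    simp only [ν, entryDistribution]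
    rw [Measure.map_finset_sum hφ.aemeasurable, Fintype.sum_prod_type]
    simp only [Measure.map_smul, Measure.map_dirac' hφ]
    rfl
  have hX := iIndepFun.hasLaw_pi hlaw hindep
  have hpm : IsProbabilityMeasure (ν.map φ) := Measure.isProbabilityMeasure_map hφ.aemeasurable
  have hpi : (Measure.pi fun _ : Fin k => entryDistribution A) =
      (Measure.pi fun _ : Fin k => ν).map fun f l => φ (f l) := by
    rw [hmap, Measure.pi_map_pi fun _ => hφ.aemeasurable]
  have hm : Measurable fun (f : Fin k → Fin d₁ × Fin d₂) l => φ (f l) := .of_discrete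
  have e : μ.real {ω | P fun l => X l ω} =
      (Measure.pi fun _ : Fin k => ν).real {f | P fun l => φ (f l)} := by
    rw [measureReal_def, measureReal_def]
    congr 1
    change μ ((fun ω l => X l ω) ⁻¹' {x | P x}) = _
    rw [← Measure.map_apply_of_aemeasurable hX.aemeasurable hP, hX.map_eq, hpi,
      Measure.map_apply hm hP]
    rfl
  rw [e]
  have hset : {f | P fun l => φ (f l)} = (Finset.univ.filter
      fun f : Fin k → Fin d₁ × Fin d₂ => P fun l => φ (f l) : Set (Fin k → Fin d₁ × Fin d₂)) := by
    ext; simp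
  rw [hset, ← sum_measureReal_singleton]
  refine Finset.sum_congr rfl fun f _ => ?_
  rw [measureReal_def, Measure.pi_singleton, ENNReal.toReal_prod]
  exact Finset.prod_congr rfl fun l _ => by rw [hν1, ENNReal.toReal_ofReal (hp0 _ _)]

end EntrySampling

/-! ### Concentration of linear images of the sample average -/

section Concentration

variable {d₁ d₂ : ℕ} {A : Matrix (Fin d₁) (Fin d₂) ℝ}
variable {n : Type*} [Fintype n] [DecidableEq n]

/-- With `s = d₁ + d₂`, the numerical content of the sample size bound: at the parameter
`θ = ε / (2 s)` the matrix Bernstein bound for variance `s` and deviation `k ε` is at most `p`. -/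
theorem two_mul_exp_le {s ε p N : ℝ} {k : ℕ} (hs : 2 ≤ s) (hN : N ≤ s)
    (hε : ε ∈ Set.Ioo (0 : ℝ) 1) (hp : p ∈ Set.Ioo (0 : ℝ) 1)
    (hk : 128 * (s / ε ^ 2) * Real.log (s / p) ≤ k) :
    2 * N * Real.exp (k * ((ε / (2 * s)) ^ 2 * s) - ε / (2 * s) * (k * ε)) ≤ p := by
  have hε0 := hε.1
  have hp0 := hp.1
  have hs0 : 0 < s := by linarith
  have hlog : 0 ≤ Real.log (s / p) :=
    Real.log_nonneg ((one_le_div hp0).2 (by linarith [hp.2]))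
  have h1 : k * ((ε / (2 * s)) ^ 2 * s) - ε / (2 * s) * (k * ε) =
      -(k * (ε ^ 2 / (4 * s))) := by
    field_simp
    ring
  have h2 : 32 * Real.log (s / p) ≤ k * (ε ^ 2 / (4 * s)) := by
    calc 32 * Real.log (s / p)
        = 128 * (s / ε ^ 2) * Real.log (s / p) * (ε ^ 2 / (4 * s)) := by
          field_simp
          ring
      _ ≤ _ := by gcongr
  have h3 : Real.exp (k * ((ε / (2 * s)) ^ 2 * s) - ε / (2 * s) * (k * ε)) ≤ (p / s) ^ 2 := by
    rw [h1, ← Real.exp_log (show (0 : ℝ) < (p / s) ^ 2 by positivity), Real.log_pow,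
      ← inv_div s p, Real.log_inv]
    apply Real.exp_le_exp.2
    push_cast
    linarith
  calc _ ≤ 2 * s * (p / s) ^ 2 := by gcongr
    _ = p * (2 * p / s) := by field_simp
    _ ≤ p * 1 := by
      gcongr
      rw [div_le_one hs0]
      linarith [hp.2]
    _ = p := mul_one p

/-- Concentration of the image of the sample average under a linear map `T` into symmetric matrices,
provided that the images of the matrix units have diagonal squares `D i j`. The sampled entry is
`s * (r c / (r + c))` with `s = d₁ + d₂`, so `hb` bounds the norm of the image of a sample by `s`,
and `hv` bounds its second moment by `s` in the Loewner order. -/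
theorem measureReal_le_norm_map_sampleAverage_sub_le
    (hA : ∀ i j, 0 ≤ A i j) (hr : ∀ i, 0 < rowSum A i) (hc : ∀ j, 0 < colSum A j)
    {ε p : ℝ} (hε : ε ∈ Set.Ioo (0 : ℝ) 1) (hp : p ∈ Set.Ioo (0 : ℝ) 1) {k : ℕ}
    (hd : 2 ≤ d₁ + d₂)
    (hk : 128 * (((d₁ : ℝ) + d₂) / ε ^ 2) * Real.log (((d₁ : ℝ) + d₂) / p) ≤ (k : ℝ))
    {Ω : Type*} [MeasurableSpace Ω] {μ : Measure Ω} [IsProbabilityMeasure μ]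
    {X : Fin k → Ω → Matrix (Fin d₁) (Fin d₂) ℝ}
    (hlaw : ∀ l, HasLaw (X l) (entryDistribution A) μ) (hindep : iIndepFun X μ)
    (T : Matrix (Fin d₁) (Fin d₂) ℝ →ₗ[ℝ] Matrix n n ℝ) (hT : ∀ M, (T M).IsHermitian)
    (hn : Fintype.card n ≤ d₁ + d₂) (D : Fin d₁ → Fin d₂ → n → ℝ)
    (hD : ∀ i j, T (Matrix.single i j 1) ^ 2 = Matrix.diagonal (D i j))
    (hb0 : ∀ i j x, 0 ≤ D i j x)
    (hb : ∀ i j x, (rowSum A i * colSum A j / (rowSum A i + colSum A j)) ^ 2 * D i j x ≤ 1)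
    (hv : ∀ x, ∑ i, ∑ j,
      A i j * (rowSum A i * colSum A j / (rowSum A i + colSum A j)) * D i j x ≤ 1) :
    μ.real {ω | ε ≤ ‖T (sampleAverage (fun l => X l ω) - A)‖} ≤ p := by
  set s : ℝ := (d₁ : ℝ) + d₂ with hs
  have hs2 : 2 ≤ s := by rw [hs]; exact_mod_cast hd
  have hs0 : 0 < s := by linarith
  have hk0 : (0 : ℝ) < k := by
    refine lt_of_lt_of_le ?_ hk
    have := hε.1
    have := Real.log_pos ((one_lt_div hp.1).2 (show p < s by linarith [hp.2]))
    positivity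
  have hP : MeasurableSet {x : Fin k → Matrix (Fin d₁) (Fin d₂) ℝ |
      ε ≤ ‖T (sampleAverage x - A)‖} := by
    have hT' : Continuous T := T.continuous_of_finiteDimensional
    have : Continuous fun x : Fin k → Matrix (Fin d₁) (Fin d₂) ℝ =>
        ‖T (sampleAverage x - A)‖ := by
      unfold sampleAverage
      fun_prop
    exact measurableSet_le measurable_const this.measurable
  classical
  rw [measureReal_preimage_eq_sum (by omega) hA hr hc hlaw hindep
    (P := fun x => ε ≤ ‖T (sampleAverage x - A)‖) hP]
  let w : Fin d₁ × Fin d₂ → ℝ := fun x => entryProb A x.1 x.2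
  let q : Fin d₁ × Fin d₂ → ℝ := fun x => A x.1 x.2 / entryProb A x.1 x.2
  let Z : Fin d₁ × Fin d₂ → Matrix n n ℝ := fun x => T (Matrix.single x.1 x.2 (q x))
  have hw : ∀ x, 0 ≤ w x := fun x => entryProb_nonneg hA hr hc _ _
  have hw1 : ∑ x, w x = 1 := by
    rw [Fintype.sum_prod_type]
    exact sum_sum_entryProb (by omega) hr hc
  have hZ : ∀ x, Z x = q x • T (Matrix.single x.1 x.2 1) := fun x => by
    rw [← map_smul, Matrix.smul_single, smul_eq_mul, mul_one]
  have hZsq : ∀ x, Z x ^ 2 = Matrix.diagonal fun a => q x ^ 2 * D x.1 x.2 a := fun x => by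
    rw [hZ, smul_pow, hD, ← Matrix.diagonal_smul]
    rfl
  have hwZ : ∑ x, w x • Z x = T A := by
    conv_rhs => rw [Matrix.matrix_eq_sum_single A]
    rw [Fintype.sum_prod_type, map_sum]
    refine Finset.sum_congr rfl fun i _ => ?_
    rw [map_sum]
    refine Finset.sum_congr rfl fun j _ => ?_
    rw [← map_smul, Matrix.smul_single, smul_eq_mul]
    exact congrArg (fun t => T (Matrix.single i j t)) (entryProb_mul_div (hr i) (hc j))
  have hZn : ∀ x, ‖Z x‖ ≤ s := fun x => by
    have h : ‖Z x ^ 2‖ ≤ s ^ 2 := by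
      rw [hZsq, Matrix.l2_opNorm_diagonal]
      refine (pi_norm_le_iff_of_nonneg (by positivity)).2 fun a => ?_
      have h0 := hb0 x.1 x.2 a
      rw [Real.norm_of_nonneg (by positivity)]
      by_cases h : A x.1 x.2 = 0
      · simpa [q, h] using sq_nonneg s
      · simp only [q]
        rw [div_entryProb_of_ne_zero (hr _) (hc _) h, mul_pow, mul_assoc]
        exact mul_le_of_le_one_right (by positivity) (hb _ _ _)
    have h' : ‖Z x ^ 2‖ = ‖Z x‖ ^ 2 := by
      have := Matrix.l2_opNorm_conjTranspose_mul_self (Z x)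
      rwa [(hT _).eq, ← sq, ← sq] at this
    exact le_of_sq_le_sq (h' ▸ h) hs0.le
  have hTA : ‖T A‖ ≤ s := by
    rw [← hwZ]
    calc _ ≤ ∑ x, w x * s := norm_sum_le_of_le _ fun x _ => by
          rw [norm_smul, Real.norm_of_nonneg (hw x)]
          exact mul_le_mul_of_nonneg_left (hZn x) (hw x)
      _ = s := by rw [← Finset.sum_mul, hw1, one_mul]
  let Y : Fin d₁ × Fin d₂ → Matrix n n ℝ := fun x => Z x - T A
  have hY : ∀ x, (Y x).IsHermitian := fun x => (hT _).sub (hT _)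
  have hY0 : ∑ x, w x • Y x = 0 := by
    simp only [Y, smul_sub, Finset.sum_sub_distrib, hwZ, ← Finset.sum_smul, hw1, one_smul, sub_self]
  have hθ : ∀ x, ‖(ε / (2 * s)) • Y x‖ ≤ 1 := fun x => by
    have hε0 := hε.1
    rw [norm_smul, Real.norm_of_nonneg (by positivity)]
    have : ‖Y x‖ ≤ 2 * s := (norm_sub_le _ _).trans (by linarith [hZn x])
    calc _ ≤ ε / (2 * s) * (2 * s) := by gcongr
      _ = ε := div_mul_cancel₀ _ (by positivity)
      _ ≤ 1 := hε.2.le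
  have hvar : (s • (1 : Matrix n n ℝ) - ∑ x, w x • Y x ^ 2).PosSemidef := by
    -- The variance is the second moment minus the square of the mean.
    have e1 : ∑ x, w x • Y x ^ 2 = ∑ x, w x • Z x ^ 2 - T A ^ 2 := by
      have : ∀ x, w x • Y x ^ 2 =
          w x • Z x ^ 2 - (w x • Z x) * T A - T A * (w x • Z x) + w x • T A ^ 2 := fun x => by
        simp only [Y, sq, sub_mul, mul_sub, smul_sub, smul_mul_assoc, mul_smul_comm]
        abel
      simp only [this, Finset.sum_add_distrib, Finset.sum_sub_distrib, ← Finset.sum_mul,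
        ← Finset.mul_sum, ← Finset.sum_smul, hwZ, hw1, one_smul]
      rw [← sq]
      abel
    have e2 : s • (1 : Matrix n n ℝ) - ∑ x, w x • Z x ^ 2 =
        Matrix.diagonal fun a => s * (1 - ∑ i, ∑ j,
          A i j * (rowSum A i * colSum A j / (rowSum A i + colSum A j)) * D i j a) := by
      have : ∀ x, w x • Z x ^ 2 = Matrix.diagonal fun a => s * (A x.1 x.2 *
          (rowSum A x.1 * colSum A x.2 / (rowSum A x.1 + colSum A x.2)) * D x.1 x.2 a) := by
        intro x
        rw [hZsq, ← Matrix.diagonal_smul]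
        congr 1
        ext a
        have := entryProb_mul_div_sq (hr x.1) (hc x.2)
        simp only [Pi.smul_apply, smul_eq_mul, w, q]
        rw [← mul_assoc, this]
        ring
      ext a b
      simp only [this, Matrix.sub_apply, Matrix.smul_apply, Matrix.sum_apply, Matrix.one_apply,
        Matrix.diagonal_apply, Fintype.sum_prod_type, smul_eq_mul]
      split_ifs
      · simp only [← Finset.mul_sum]
        ring
      · simp
    rw [e1, sub_sub_eq_add_sub, add_sub_right_comm, e2]
    refine (Matrix.PosSemidef.diagonal fun a => ?_).add ?_
    · exact mul_nonneg hs0.le (sub_nonneg.2 (hv a))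
    · have := Matrix.posSemidef_conjTranspose_mul_self (T A)
      rwa [(hT _).eq, ← sq] at this
  have hev : ∀ f : Fin k → Fin d₁ × Fin d₂,
      ε ≤ ‖T (sampleAverage (fun l => Matrix.single (f l).1 (f l).2 (q (f l))) - A)‖ ↔
        k * ε ≤ ‖∑ l, Y (f l)‖ := fun f => by
    have : ∑ l, Y (f l) =
        (k : ℝ) • T (sampleAverage (fun l => Matrix.single (f l).1 (f l).2 (q (f l))) - A) := by
      simp only [sampleAverage, map_sub, map_smul, map_sum, smul_sub, smul_smul]
      rw [mul_one_div_cancel hk0.ne', one_smul]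
      rw [Finset.sum_sub_distrib, Finset.sum_const, Finset.card_univ, Fintype.card_fin,
        Nat.cast_smul_eq_nsmul]
    rw [this, norm_smul, Real.norm_natCast, mul_le_mul_iff_right₀ hk0]
  have key := sum_prod_filter_le_norm_sum_le hw hw1 hY hY0
    (div_nonneg hε.1.le (by positivity)) hθ hvar (mul_pos hk0 hε.1) k
  refine le_trans ?_ (key.trans (two_mul_exp_le hs2 ?_ hε hp hk))
  · refine le_of_eq ?_
    congr 1
    exact Finset.filter_congr fun f _ => hev f
  · rw [hs]
    exact_mod_cast hn

end Concentration

/-! ### The three normalizations -/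

section Normalizations

variable {d₁ d₂ : ℕ}

/-- The symmetric dilation `[[0, M'], [M'ᵀ, 0]]` of `M' = P M Q`, as a linear function of `M`. -/
def dilation (P : Matrix (Fin d₁) (Fin d₁) ℝ) (Q : Matrix (Fin d₂) (Fin d₂) ℝ) :
    Matrix (Fin d₁) (Fin d₂) ℝ →ₗ[ℝ] Matrix (Fin d₁ ⊕ Fin d₂) (Fin d₁ ⊕ Fin d₂) ℝ where
  toFun M := Matrix.fromBlocks 0 (P * M * Q) (P * M * Q)ᵀ 0
  map_add' M N := by
    rw [Matrix.fromBlocks_add, ← Matrix.transpose_add, Matrix.mul_add, Matrix.add_mul, add_zero, add_zero]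
  map_smul' t M := by
    rw [RingHom.id_apply, Matrix.fromBlocks_smul, ← Matrix.transpose_smul, smul_zero, smul_zero,
      Matrix.mul_smul, Matrix.smul_mul]

theorem dilation_apply (P : Matrix (Fin d₁) (Fin d₁) ℝ) (Q : Matrix (Fin d₂) (Fin d₂) ℝ)
    (M : Matrix (Fin d₁) (Fin d₂) ℝ) :
    dilation P Q M = Matrix.fromBlocks 0 (P * M * Q) (P * M * Q)ᵀ 0 := rfl

theorem isHermitian_dilation (P : Matrix (Fin d₁) (Fin d₁) ℝ) (Q : Matrix (Fin d₂) (Fin d₂) ℝ)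
    (M : Matrix (Fin d₁) (Fin d₂) ℝ) : (dilation P Q M).IsHermitian :=
  Matrix.IsHermitian.fromBlocks Matrix.isHermitian_zero
    (Matrix.conjTranspose_eq_transpose_of_trivial _) Matrix.isHermitian_zero

theorem l2_opNorm_one_le {n : Type*} [Fintype n] [DecidableEq n] :
    ‖(1 : Matrix n n ℝ)‖ ≤ 1 := by
  rw [← Matrix.diagonal_one, Matrix.l2_opNorm_diagonal]
  exact (pi_norm_le_iff_of_nonneg zero_le_one).2 fun _ => by simp

theorem norm_le_one_of_conjTranspose_mul_self {m n : Type*} [Fintype m] [Fintype n]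
    [DecidableEq n] {V : Matrix m n ℝ} (h : Vᴴ * V = 1) : ‖V‖ ≤ 1 := by
  have h1 := Matrix.l2_opNorm_conjTranspose_mul_self V
  rw [h] at h1
  nlinarith [l2_opNorm_one_le (n := n)]

/-- `M' = P M Q` is a corner of its dilation, cut out by two isometries. -/
theorem norm_le_norm_dilation (P : Matrix (Fin d₁) (Fin d₁) ℝ) (Q : Matrix (Fin d₂) (Fin d₂) ℝ)
    (M : Matrix (Fin d₁) (Fin d₂) ℝ) : ‖P * M * Q‖ ≤ ‖dilation P Q M‖ := by
  let V : Matrix (Fin d₁ ⊕ Fin d₂) (Fin d₁) ℝ := Matrix.fromRows 1 0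
  let W : Matrix (Fin d₁ ⊕ Fin d₂) (Fin d₂) ℝ := Matrix.fromRows 0 1
  have hVt : Vᴴ = Matrix.fromCols 1 0 := by
    simp only [V, Matrix.conjTranspose_fromRows_eq_fromCols_conjTranspose,
      Matrix.conjTranspose_one, Matrix.conjTranspose_zero]
  have hWt : Wᴴ = Matrix.fromCols 0 1 := by
    simp only [W, Matrix.conjTranspose_fromRows_eq_fromCols_conjTranspose,
      Matrix.conjTranspose_one, Matrix.conjTranspose_zero]
  have hV : ‖V‖ ≤ 1 := norm_le_one_of_conjTranspose_mul_self (by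
    rw [hVt, Matrix.fromCols_mul_fromRows]; simp)
  have hW : ‖W‖ ≤ 1 := norm_le_one_of_conjTranspose_mul_self (by
    rw [hWt, Matrix.fromCols_mul_fromRows]; simp)
  have e : P * M * Q = Vᴴ * dilation P Q M * W := by
    rw [hVt, dilation_apply, Matrix.fromCols_mul_fromBlocks, Matrix.fromCols_mul_fromRows]
    simp
  rw [e]
  calc _ ≤ ‖Vᴴ‖ * ‖dilation P Q M‖ * ‖W‖ := (Matrix.l2_opNorm_mul _ _).trans
        (mul_le_mul_of_nonneg_right (Matrix.l2_opNorm_mul _ _) (norm_nonneg _))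
    _ ≤ 1 * ‖dilation P Q M‖ * 1 := by
      rw [Matrix.l2_opNorm_conjTranspose]
      gcongr
    _ = _ := by ring

theorem sq_dilation_single (u : Fin d₁ → ℝ) (v : Fin d₂ → ℝ) (i : Fin d₁) (j : Fin d₂) :
    dilation (Matrix.diagonal u) (Matrix.diagonal v) (Matrix.single i j 1) ^ 2 =
      Matrix.diagonal (Sum.elim (Pi.single i ((u i * v j) ^ 2)) (Pi.single j ((u i * v j) ^ 2))) := by
  have h : Matrix.diagonal u * Matrix.single i j (1 : ℝ) * Matrix.diagonal v =
      Matrix.single i j (u i * v j) := by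
    ext a b
    simp only [Matrix.mul_diagonal, Matrix.diagonal_mul, Matrix.single_apply]
    split_ifs with hab
    · rw [hab.1, hab.2, mul_one]
    · simp
  rw [dilation_apply, h, Matrix.transpose_single, sq, Matrix.fromBlocks_multiply,
    Matrix.single_mul_single_same, Matrix.single_mul_single_same, ← Matrix.fromBlocks_diagonal,
    Matrix.diagonal_single, Matrix.diagonal_single]
  simp [sq]

/-- The diagonal matrix of row sums of `P M`, as a linear function of `M`. -/
def rowSumDiagonal (P : Matrix (Fin d₁) (Fin d₁) ℝ) :
    Matrix (Fin d₁) (Fin d₂) ℝ →ₗ[ℝ] Matrix (Fin d₁) (Fin d₁) ℝ where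
  toFun M := Matrix.diagonal ((P * M) *ᵥ 1)
  map_add' M N := by rw [Matrix.mul_add, Matrix.add_mulVec, Matrix.diagonal_add]; rfl
  map_smul' t M := by
    rw [RingHom.id_apply, Matrix.mul_smul, Matrix.smul_mulVec, Matrix.diagonal_smul]

theorem rowSumDiagonal_apply (P : Matrix (Fin d₁) (Fin d₁) ℝ) (M : Matrix (Fin d₁) (Fin d₂) ℝ) :
    rowSumDiagonal P M = Matrix.diagonal ((P * M) *ᵥ 1) := rfl

theorem sq_rowSumDiagonal_single (u : Fin d₁ → ℝ) (i : Fin d₁) (j : Fin d₂) :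
    rowSumDiagonal (Matrix.diagonal u) (Matrix.single i j 1) ^ 2 =
      Matrix.diagonal (Pi.single i (u i ^ 2)) := by
  have h : (Matrix.diagonal u * Matrix.single i j (1 : ℝ)) *ᵥ 1 = Pi.single i (u i) := by
    ext a
    rw [← Matrix.mulVec_mulVec, Matrix.mulVec_diagonal]
    by_cases hai : a = i
    · subst hai; simp [Matrix.mulVec, dotProduct, Matrix.single_apply]
    · simp [Matrix.mulVec, dotProduct, hai, Ne.symm hai]
  rw [rowSumDiagonal_apply, h, sq, Matrix.diagonal_mul_diagonal]
  congr 1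
  ext a
  by_cases hai : a = i
  · subst hai; simp [sq]
  · simp [hai]

theorem sq_mul_div_add_mul_inv_sq_le_one {x y : ℝ} (hx : 0 < x) (hy : 0 < y) :
    (x * y / (x + y)) ^ 2 * (x⁻¹) ^ 2 ≤ 1 := by
  have e : x * y / (x + y) * x⁻¹ = y / (x + y) := by field_simp
  rw [← mul_pow, e]
  exact pow_le_one₀ (by positivity) ((div_le_one (by positivity)).2 (by linarith))

theorem mul_div_add_mul_inv_sq_le {a x y : ℝ} (ha : 0 ≤ a) (hx : 0 < x) (hy : 0 < y) :
    a * (x * y / (x + y)) * (x⁻¹) ^ 2 ≤ a / x := by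
  have e : a * (x * y / (x + y)) * (x⁻¹) ^ 2 = a / x * (y / (x + y)) := by field_simp
  rw [e]
  exact mul_le_of_le_one_right (by positivity) ((div_le_one (by positivity)).2 (by linarith))

end Normalizations

/-- Here `‖·‖` is the spectral norm (the `ℓ²` operator norm) on matrices and the maximum norm on
vectors `Fin d → ℝ`. -/
theorem mainTheorem6 {d₁ d₂ : ℕ} (A : Matrix (Fin d₁) (Fin d₂) ℝ)
    (hA : ∀ i j, 0 ≤ A i j)
    (hrow : ∀ i, ∃ j, A i j ≠ 0) (hcol : ∀ j, ∃ i, A i j ≠ 0)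
    (ε p : ℝ) (hε : ε ∈ Set.Ioo (0 : ℝ) 1) (hp : p ∈ Set.Ioo (0 : ℝ) 1)
    (k : ℕ)
    (hk : 128 * (((d₁ : ℝ) + d₂) / ε ^ 2) * Real.log (((d₁ : ℝ) + d₂) / p) ≤ (k : ℝ))
    {Ω : Type*} [MeasurableSpace Ω] (μ : Measure Ω) [IsProbabilityMeasure μ]
    (X : Fin k → Ω → Matrix (Fin d₁) (Fin d₂) ℝ)
    (hlaw : ∀ l, HasLaw (X l) (entryDistribution A) μ)
    (hindep : iIndepFun X μ) :
    μ.real {ω | ε ≤ ‖diagPow (rowSum A) (-1 / 2) *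
        (sampleAverage (fun l => X l ω) - A) * diagPow (colSum A) (-1 / 2)‖} ≤ p ∧
    μ.real {ω | ε ≤ ‖(diagPow (rowSum A) (-1) *
        (sampleAverage (fun l => X l ω) - A)) *ᵥ (1 : Fin d₂ → ℝ)‖} ≤ p ∧
    μ.real {ω | ε ≤ ‖(diagPow (colSum A) (-1) *
        (sampleAverage (fun l => X l ω) - A)ᵀ) *ᵥ (1 : Fin d₁ → ℝ)‖} ≤ p := by
  have hr := rowSum_pos hA hrow
  have hc := colSum_pos hA hcol
  rcases Nat.eq_zero_or_pos d₁ with h0 | hd₁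
  -- Without rows there are no columns either, and all three norms vanish.
  · have h0' : d₂ = 0 := by
      by_contra h
      obtain ⟨i, -⟩ := hcol ⟨0, Nat.pos_of_ne_zero h⟩
      exact absurd i.pos (by omega)
    subst h0 h0'
    have h1 : ∀ M : Matrix (Fin 0) (Fin 0) ℝ, ‖M‖ = 0 := fun M => by
      rw [Subsingleton.elim M 0, norm_zero]
    have h2 : ∀ v : Fin 0 → ℝ, ‖v‖ = 0 := fun v => by rw [Subsingleton.elim v 0, norm_zero]
    simp [h1, h2, hε.1.not_ge, hp.1.le]
  have hd₂ : 0 < d₂ := by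
    obtain ⟨j, -⟩ := hrow ⟨0, hd₁⟩
    exact j.pos
  have hd : 2 ≤ d₁ + d₂ := by omega
  have hhalf : ∀ {x : ℝ}, 0 < x → (x ^ (-1 / 2 : ℝ)) ^ 2 = x⁻¹ := fun {x} hx => by
    rw [← Real.rpow_natCast, ← Real.rpow_mul hx.le, ← Real.rpow_neg_one]
    norm_num
  refine ⟨?_, ?_, ?_⟩
  · refine le_trans (measureReal_mono fun ω hω => le_trans hω (norm_le_norm_dilation _ _ _))
      (measureReal_le_norm_map_sampleAverage_sub_le hA hr hc hε hp hd hk hlaw hindep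
        (dilation (diagPow (rowSum A) (-1 / 2)) (diagPow (colSum A) (-1 / 2)))
        (isHermitian_dilation _ _) (by simp) _ (sq_dilation_single _ _) ?_ ?_ ?_)
    · rintro i j (a | b)
      · by_cases h : a = i
        · subst h; simpa using sq_nonneg _
        · simp [h]
      · by_cases h : b = j
        · subst h; simpa using sq_nonneg _
        · simp [h]
    · have key : ∀ i j, (rowSum A i * colSum A j / (rowSum A i + colSum A j)) ^ 2 *
          (rowSum A i ^ (-1 / 2 : ℝ) * colSum A j ^ (-1 / 2 : ℝ)) ^ 2 ≤ 1 := by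
        intro i j
        have := hr i
        have := hc j
        rw [mul_pow, hhalf (hr i), hhalf (hc j)]
        have e : (rowSum A i * colSum A j / (rowSum A i + colSum A j)) ^ 2 *
            ((rowSum A i)⁻¹ * (colSum A j)⁻¹) =
            rowSum A i * colSum A j / (rowSum A i + colSum A j) ^ 2 := by
          field_simp
        rw [e, div_le_one (by positivity)]
        nlinarith
      rintro i j (a | b)
      · by_cases h : a = i
        · subst h; simpa only [Sum.elim_inl, Pi.single_eq_same] using key a j
        · simp [h]
      · by_cases h : b = j
        · subst h; simpa only [Sum.elim_inr, Pi.single_eq_same] using key i b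
        · simp [h]
    · have key : ∀ i j, A i j * (rowSum A i * colSum A j / (rowSum A i + colSum A j)) *
          (rowSum A i ^ (-1 / 2 : ℝ) * colSum A j ^ (-1 / 2 : ℝ)) ^ 2 =
            A i j / (rowSum A i + colSum A j) := by
        intro i j
        have := hr i
        have := hc j
        rw [mul_pow, hhalf (hr i), hhalf (hc j)]
        field_simp
      rintro (a | b)
      · refine le_of_le_of_eq ?_ (sum_sum_single_div_rowSum hr a)
        refine Finset.sum_le_sum fun i _ => Finset.sum_le_sum fun j _ => ?_
        by_cases h : a = i
        · subst h
          simp only [Sum.elim_inl, Pi.single_eq_same]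
          rw [key]
          exact div_le_div_of_nonneg_left (hA _ _) (hr _) (by linarith [hc j])
        · simp [h]
      · refine le_of_le_of_eq ?_ (sum_sum_single_div_colSum hc b)
        refine Finset.sum_le_sum fun i _ => Finset.sum_le_sum fun j _ => ?_
        by_cases h : b = j
        · subst h
          simp only [Sum.elim_inr, Pi.single_eq_same]
          rw [key]
          exact div_le_div_of_nonneg_left (hA _ _) (hc _) (by linarith [hr i])
        · simp [h]
  · have hev : ∀ M : Matrix (Fin d₁) (Fin d₂) ℝ,
        ‖(diagPow (rowSum A) (-1) * M) *ᵥ (1 : Fin d₂ → ℝ)‖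
        = ‖rowSumDiagonal (diagPow (rowSum A) (-1)) M‖ := fun M => by
      rw [rowSumDiagonal_apply, Matrix.l2_opNorm_diagonal]
    simp only [hev]
    refine measureReal_le_norm_map_sampleAverage_sub_le hA hr hc hε hp hd hk hlaw hindep
      (rowSumDiagonal (diagPow (rowSum A) (-1))) (fun M => Matrix.isHermitian_diagonal _) (by simp)
      _ (sq_rowSumDiagonal_single _) ?_ ?_ ?_
    · intro i j a
      by_cases h : a = i
      · subst h; simpa using sq_nonneg _
      · simp [h]
    · intro i j a
      by_cases h : a = i
      · subst h
        rw [Pi.single_eq_same, Real.rpow_neg_one]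
        exact sq_mul_div_add_mul_inv_sq_le_one (hr a) (hc j)
      · simp [h]
    · intro a
      refine le_of_le_of_eq ?_ (sum_sum_single_div_rowSum hr a)
      refine Finset.sum_le_sum fun i _ => Finset.sum_le_sum fun j _ => ?_
      by_cases h : a = i
      · subst h
        rw [Pi.single_eq_same, Pi.single_eq_same, Real.rpow_neg_one]
        exact mul_div_add_mul_inv_sq_le (hA a j) (hr a) (hc j)
      · simp [h]
  · have hev : ∀ M : Matrix (Fin d₁) (Fin d₂) ℝ,
        ‖(diagPow (colSum A) (-1) * Mᵀ) *ᵥ (1 : Fin d₁ → ℝ)‖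
        = ‖((rowSumDiagonal (diagPow (colSum A) (-1))).comp
            (Matrix.transposeLinearEquiv (Fin d₁) (Fin d₂) ℝ ℝ).toLinearMap) M‖ := fun M => by
      rw [← Matrix.l2_opNorm_diagonal]
      rfl
    simp only [hev]
    refine measureReal_le_norm_map_sampleAverage_sub_le hA hr hc hε hp hd hk hlaw hindep
      _ (fun M => Matrix.isHermitian_diagonal _) (by simp)
      (fun i j => Pi.single j ((colSum A j ^ (-1 : ℝ)) ^ 2)) ?_ ?_ ?_ ?_
    · intro i j
      refine Eq.trans ?_ (sq_rowSumDiagonal_single (fun j => colSum A j ^ (-1 : ℝ)) j i)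
      rw [← Matrix.transpose_single]
      rfl
    · intro i j a
      by_cases h : a = j
      · subst h; simpa using sq_nonneg _
      · simp [h]
    · intro i j a
      by_cases h : a = j
      · subst h
        rw [Pi.single_eq_same, Real.rpow_neg_one, mul_comm (rowSum A i), add_comm (rowSum A i)]
        exact sq_mul_div_add_mul_inv_sq_le_one (hc a) (hr i)
      · simp [h]
    · intro a
      refine le_of_le_of_eq ?_ (sum_sum_single_div_colSum hc a)
      refine Finset.sum_le_sum fun i _ => Finset.sum_le_sum fun j _ => ?_
      by_cases h : a = j
      · subst h
        rw [Pi.single_eq_same, Pi.single_eq_same, Real.rpow_neg_one, mul_comm (rowSum A i),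
          add_comm (rowSum A i)]
        exact mul_div_add_mul_inv_sq_le (hA i a) (hc a) (hr i)
      · simp [h]
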